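/- **Theorem.** Let $(K,v)$ be a valued field (with an arbitrary Krull valuation $v$, written additively, value group $vK$ and residue field $Kv$). Assume that either the residue field $Kv$ has characteristic $0$, or $(K,v)$ is finitely ramified, i.e. there is a prime number $p$, nonzero in $K$, such that $vp>0$ and $vK$ has only finitely many elements strictly between $0$ and $vp$. Let $(F|K,v)$ be an immediate function field over $(K,v)$, that is, $F|K$ is a finitely generated field extension, $v$ is extended to $F$, and the canonical embeddings $vK\hookrightarrow vF$ and $Kv\hookrightarrow Fv$ are onto. Extend $v$ to an algebraic closure $\tilde F$ of $F$ and take henselizations of subfields of $F$ within $(\tilde F,v)$; here a henselization of a valued field $(E,v)$ is a henselian extension of $(E,v)$ that admits a unique valuation preserving embedding over $E$ into every henselian extension of $(E,v)$, and a valued field is henselian if its valuation ring satisfies Hensel's Lemma. Then $(F|K,v)$ is henselian rational, i.e. there is a transcendence basis $\mathcal T\subset F$ of $F|K$ such that $F$ is contained in the henselization $K(\mathcal T)^h$ of $(K(\mathcal T),v)$. In fact, $F\subseteq K(\mathcal T)^h$ for every transcendence basis $\mathcal T\subset F$ of $F|K$. -/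

import Mathlib

universe u

/-- A finitely generated field extension `F | K` (an algebraic function field). -/
def IsFunctionField (K F : Type*) [Field K] [Field F] [Algebra K F] : Prop :=
  (⊤ : IntermediateField K F).FG

/-- The residue field has characteristic `0`. -/
def HasResidueCharZero {K Γ : Type*} [Field K] [LinearOrderedCommGroupWithZero Γ]
    (v : Valuation K Γ) : Prop :=
  CharZero (IsLocalRing.ResidueField v.valuationSubring)

/-- There is a prime `p`, nonzero in `K`, such that (additively) `v p > 0` and the value group
`v K` has only finitely many elements strictly between `0` and `v p`.
Mathlib writes valuations multiplicatively: `v x < 1` is `v x > 0` in additive notation. -/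
def IsFinitelyRamified {K Γ : Type*} [Field K] [LinearOrderedCommGroupWithZero Γ]
    (v : Valuation K Γ) : Prop :=
  ∃ p : ℕ, p.Prime ∧ (p : K) ≠ 0 ∧ v (p : K) < 1 ∧
    {γ : Γ | γ ∈ Set.range v ∧ v (p : K) < γ ∧ γ < 1}.Finite

/-- The extension `(F | K, v)` is immediate: the canonical embeddings of value groups and of residue
fields are onto. -/
def IsImmediate {K F ΓK ΓF : Type*} [Field K] [Field F] [Algebra K F]
    [LinearOrderedCommGroupWithZero ΓK] [LinearOrderedCommGroupWithZero ΓF]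
    (vK : Valuation K ΓK) (vF : Valuation F ΓF) [vK.HasExtension vF] : Prop :=
  (∀ y : F, y ≠ 0 → ∃ x : K, x ≠ 0 ∧ vF (algebraMap K F x) = vF y) ∧
  Function.Surjective (algebraMap (IsLocalRing.ResidueField vK.valuationSubring)
    (IsLocalRing.ResidueField vF.valuationSubring))

/-- A valued field is henselian if its valuation ring satisfies Hensel's Lemma. -/
def IsHenselianValuation {K Γ : Type*} [Field K] [LinearOrderedCommGroupWithZero Γ]
    (v : Valuation K Γ) : Prop :=
  HenselianLocalRing v.valuationSubring

/-- `(L, vL)` is a henselization of `(E, vE)`: it is a henselian extension which admits a unique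
valuation preserving embedding over `E` into every henselian extension of `(E, vE)`.
(As `E` embeds into `L`, it is enough to test extensions in the universe of `L`; every valuation on
a field in this universe is equivalent to one with values in this universe.) -/
structure IsHenselization {E ΓE ΓL : Type*} {L : Type u} [Field E] [Field L] [Algebra E L]
    [LinearOrderedCommGroupWithZero ΓE] [LinearOrderedCommGroupWithZero ΓL]
    (vE : Valuation E ΓE) (vL : Valuation L ΓL) : Prop where
  hasExtension : vE.HasExtension vL
  henselian : IsHenselianValuation vL
  existsUnique_embedding : ∀ (M : Type u) [Field M] [Algebra E M]
    (ΓM : Type u) [LinearOrderedCommGroupWithZero ΓM] (vM : Valuation M ΓM),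
    vE.HasExtension vM → IsHenselianValuation vM →
      ∃! φ : L →ₐ[E] M, vL.IsEquiv (vM.comap (φ : L →+* M))

section HenselianRational

variable (K : Type*) {F Ω ΓF ΓΩ : Type*} [Field K] [Field F] [Field Ω] [Algebra K F] [Algebra F Ω]
  [LinearOrderedCommGroupWithZero ΓF] [LinearOrderedCommGroupWithZero ΓΩ]

/-- `F ⊆ K(T)^h`, where `K(T) ⊆ F` carries the restriction of the valuation `vF` of `F`, and its
henselization is taken within `(Ω, w)`, an algebraic closure of `F` with an extension of `vF`. -/
def LiesInHenselization (vF : Valuation F ΓF) (w : Valuation Ω ΓΩ) (T : Set F) : Prop :=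
  ∃ H : IntermediateField (IntermediateField.adjoin K T) Ω,
    IsHenselization (vF.comap (algebraMap (IntermediateField.adjoin K T) F))
      (w.comap (algebraMap H Ω)) ∧
    Set.range (algebraMap F Ω) ⊆ (H : Set Ω)

/-- `(F | K, v)` is henselian rational: there is a transcendence basis `T ⊆ F` of `F | K` such that
`F` lies in the henselization of `K(T)`. -/
def IsHenselianRational (vF : Valuation F ΓF) (w : Valuation Ω ΓΩ) : Prop :=
  ∃ T : Set F, IsTranscendenceBasis K ((↑) : T → F) ∧ LiesInHenselization K vF w T

end HenselianRational

/-! Put E = K(T), write values multiplicatively as |x|, and realize henselizations as decomposition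
fields of w in Ω: E^h over E, F^h over F (`isHenselization_decompositionField`). It must be shown
that the decomposition group over E fixes every α in F. The characteristic is 0, so α can be
averaged over its finite orbit under this group: the mean m lies in E^h, hence α - m lies in F^h.
Suppose α ≠ m. As F^h is immediate over F (`exists_sub_lt_of_mem_decompositionField`) and F over K,
some c in K satisfies |α - m - c| < |α - m|, and the hypothesis on residue characteristic or
ramification sharpens the bound to |n| |α - m|, with n the size of the orbit
(`exists_sub_lt_natCast_mul`). The group preserves w and fixes m and c, so |b - m - c| < |n c| for
every b in the orbit. These n differences sum to -n c, a contradiction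
(`algebraMap_mem_decompositionField`). Since c comes from K, the choice of the transcendence basis
does not matter.

The properties of the decomposition field rest on an element x close to 1 whose other conjugates all
have value less than 1 (`exists_separating_element`); it comes from the Galois action on primes of
an integral closure. The minimal polynomial of x has 1 as a simple approximate root, which gives the
universal property. Multiplying by powers of x separates the values of conjugates, and a Newton
polygon argument then gives immediacy. -/

open Polynomial IsLocalRing
open scoped Pointwise

/-! ### Centers of valuations and the Galois action on them -/

/-- The center of a valuation `w` along a ring homomorphism into its valuation ring. -/
def Valuation.centerAlong {S Ω Γ : Type*} [CommRing S] [Field Ω]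
    [LinearOrderedCommGroupWithZero Γ] (w : Valuation Ω Γ) (f : S →+* Ω)
    (hf : ∀ s, w (f s) ≤ 1) : Ideal S :=
  (maximalIdeal w.valuationSubring).comap (f.codRestrict w.valuationSubring.toSubring hf)

theorem Valuation.isUnit_iff_eq_one {Ω Γ : Type*} [Field Ω]
    [LinearOrderedCommGroupWithZero Γ] (w : Valuation Ω Γ) (x : w.valuationSubring) :
    IsUnit x ↔ w (x : Ω) = 1 :=
  Valuation.Integers.isUnit_iff_valuation_eq_one (Valuation.integer.integers w)

theorem Valuation.mem_maximalIdeal_iff_lt_one {Ω Γ : Type*} [Field Ω]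
    [LinearOrderedCommGroupWithZero Γ] (w : Valuation Ω Γ) (x : w.valuationSubring) :
    x ∈ maximalIdeal w.valuationSubring ↔ w (x : Ω) < 1 := by
  rw [mem_maximalIdeal, mem_nonunits_iff, w.isUnit_iff_eq_one]
  exact ⟨fun h ↦ lt_of_le_of_ne x.2 h, ne_of_lt⟩

section Center

variable {S Ω Γ : Type*} [CommRing S] [Field Ω] [LinearOrderedCommGroupWithZero Γ]
  (w : Valuation Ω Γ) (f : S →+* Ω)

theorem Valuation.mem_centerAlong (hf : ∀ s, w (f s) ≤ 1) {s : S} :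
    s ∈ w.centerAlong f hf ↔ w (f s) < 1 :=
  w.mem_maximalIdeal_iff_lt_one _

instance Valuation.centerAlong_isPrime (hf : ∀ s, w (f s) ≤ 1) : (w.centerAlong f hf).IsPrime :=
  Ideal.comap_isPrime _ _

theorem Valuation.le_one_of_isIntegralElem (hf : ∀ s, w (f s) ≤ 1) {b : Ω}
    (hb : f.IsIntegralElem b) : w b ≤ 1 := by
  obtain ⟨p, hp, hpb⟩ := hb
  refine (Valuation.integer.integers w).mem_of_integral
    ⟨p.map (f.codRestrict w.integer hf), hp.map _, ?_⟩
  rw [eval₂_map]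
  exact hpb

end Center

/-- Two valuations on a Galois extension `Ω` of `L` which have the same center on an integrally
closed domain `R` with field of fractions `L` have conjugate centers on the integral closure. -/
theorem exists_algEquiv_lt_one_iff {R L Ω Γ₁ Γ₂ : Type*} [CommRing R] [Field L] [Field Ω]
    [Algebra R L] [IsFractionRing R L] [IsIntegrallyClosed R] [Algebra L Ω] [Algebra R Ω]
    [IsScalarTower R L Ω] [IsGalois L Ω]
    [LinearOrderedCommGroupWithZero Γ₁] [LinearOrderedCommGroupWithZero Γ₂]
    (w₁ : Valuation Ω Γ₁) (w₂ : Valuation Ω Γ₂)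
    (h₁ : ∀ r : R, w₁ (algebraMap R Ω r) ≤ 1) (h₂ : ∀ r : R, w₂ (algebraMap R Ω r) ≤ 1)
    (h : ∀ r : R, w₁ (algebraMap R Ω r) < 1 ↔ w₂ (algebraMap R Ω r) < 1) :
    ∃ τ : Ω ≃ₐ[L] Ω, ∀ b : Ω, IsIntegral R b → (w₂ (τ b) < 1 ↔ w₁ b < 1) := by
  let B := integralClosure R Ω
  have : IsDomain R := (IsFractionRing.injective R L).isDomain _
  have : Algebra.IsAlgebraic R Ω :=
    (IsFractionRing.comap_isAlgebraic_iff (A := R) (K := L)).mpr inferInstance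
  have hinj : Function.Injective (algebraMap R Ω) := by
    rw [IsScalarTower.algebraMap_eq R L Ω]
    exact (algebraMap L Ω).injective.comp (IsFractionRing.injective R L)
  have : IsFractionRing B Ω := integralClosure.isFractionRing_of_algebraic
    fun x hx ↦ (map_eq_zero_iff _ hinj).mp hx
  let := IsIntegralClosure.MulSemiringAction R L Ω B
  have hsmul (g : Ω ≃ₐ[L] Ω) (b : B) : ((g • b : B) : Ω) = g b :=
    algebraMap_galRestrict_apply R g b
  have : SMulCommClass (Ω ≃ₐ[L] Ω) R B := ⟨fun g r b ↦ by
    apply Subtype.ext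
    rw [hsmul]
    simp only [Algebra.smul_def, MulMemClass.coe_mul, map_mul, hsmul]
    congr 1
    change g (algebraMap R Ω r) = algebraMap R Ω r
    rw [IsScalarTower.algebraMap_apply R L Ω, AlgEquiv.commutes]⟩
  -- A Galois-invariant element of `B` lies in `L` and is integral over `R`, hence lies in `R`.
  have : Algebra.IsInvariant R B (Ω ≃ₐ[L] Ω) := ⟨fun b hb ↦ by
    have hb' : (b : Ω) ∈ IntermediateField.fixedField (⊤ : Subgroup (Ω ≃ₐ[L] Ω)) := by
      rintro ⟨g, -⟩
      exact (hsmul g b).symm.trans (congrArg _ (hb g))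
    rw [InfiniteGalois.fixedField_bot, IntermediateField.mem_bot] at hb'
    obtain ⟨l, hl⟩ := hb'
    have hint : IsIntegral R (algebraMap L Ω l) := hl ▸ b.2
    rw [isIntegral_algebraMap_iff (algebraMap L Ω).injective] at hint
    obtain ⟨r, rfl⟩ := IsIntegrallyClosed.algebraMap_eq_of_integral hint
    refine ⟨r, Subtype.ext ?_⟩
    rw [← hl, ← IsScalarTower.algebraMap_apply]
    rfl⟩
  -- Stabilizers of algebraic elements are open, so the profinite Galois group acts continuously on
  -- discrete `B` and transitively on the primes over a given prime of `R`.
  let : TopologicalSpace B := ⊥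
  have : DiscreteTopology B := ⟨rfl⟩
  have : ContinuousSMul (Ω ≃ₐ[L] Ω) B := by
    refine (continuousSMul_iff_stabilizer_isOpen (M := Ω ≃ₐ[L] Ω) (X := B)).mpr fun b ↦ ?_
    convert! stabilizer_isOpen_of_isIntegral (K := L) (b : Ω) using 1
    ext g
    simp only [SetLike.mem_coe, MulAction.mem_stabilizer_iff, AlgEquiv.smul_def,
      ← Subtype.coe_inj, hsmul]
  have hB₁ (b : B) : w₁ (algebraMap B Ω b) ≤ 1 := w₁.le_one_of_isIntegralElem _ h₁ b.2
  have hB₂ (b : B) : w₂ (algebraMap B Ω b) ≤ 1 := w₂.le_one_of_isIntegralElem _ h₂ b.2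
  obtain ⟨g, hg⟩ := Algebra.IsInvariant.exists_smul_of_under_eq_of_profinite (A := R)
    (G := Ω ≃ₐ[L] Ω) (w₁.centerAlong (algebraMap B Ω) hB₁) (w₂.centerAlong (algebraMap B Ω) hB₂)
    (by
      ext r
      simp only [Ideal.mem_comap, Valuation.mem_centerAlong]
      exact h r)
  refine ⟨g, fun b hb ↦ ?_⟩
  have := Ideal.smul_mem_pointwise_smul_iff (a := g) (S := w₁.centerAlong (algebraMap B Ω) hB₁)
    (x := ⟨b, hb⟩)
  rw [← hg, Valuation.mem_centerAlong, Valuation.mem_centerAlong] at this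
  rw [← hsmul g ⟨b, hb⟩]
  exact this

/-! ### Extensions of a valuation to an algebraic extension -/

section Fractions

variable {E Ω ΓE Γ₁ Γ₂ : Type*} [Field E] [Field Ω] [Algebra E Ω]
  [LinearOrderedCommGroupWithZero ΓE] [LinearOrderedCommGroupWithZero Γ₁]
  [LinearOrderedCommGroupWithZero Γ₂]

/-- A nonzero polynomial over a valued field can be scaled to have coefficients in the valuation
ring, not all of them in the maximal ideal. -/
theorem exists_valuation_coeff_C_mul (v : Valuation E ΓE) {p : E[X]} (hp : p ≠ 0) :
    ∃ c : E, c ≠ 0 ∧ (∀ i, v ((C c * p).coeff i) ≤ 1) ∧ ∃ i, v ((C c * p).coeff i) = 1 := by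
  obtain ⟨j, hj, hmax⟩ := p.support.exists_max_image (fun i ↦ v (p.coeff i))
    (Polynomial.support_nonempty.mpr hp)
  have hj0 : p.coeff j ≠ 0 := Polynomial.mem_support_iff.mp hj
  refine ⟨(p.coeff j)⁻¹, inv_ne_zero hj0, fun i ↦ ?_, j, by simp [hj0]⟩
  by_cases hi : i ∈ p.support
  · rw [coeff_C_mul, map_mul, map_inv₀, inv_mul_le_one₀]
    · exact hmax i hi
    · exact zero_lt_iff.mpr ((map_ne_zero v).mpr hj0)
  · simp [Polynomial.notMem_support_iff.mp hi]

theorem le_one_of_isIntegral_valuationSubring (vE : Valuation E ΓE) (w : Valuation Ω Γ₁)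
    [vE.HasExtension w] {b : Ω} (hb : IsIntegral vE.valuationSubring b) : w b ≤ 1 :=
  w.le_one_of_isIntegralElem (algebraMap vE.valuationSubring Ω)
    (fun r ↦ (Valuation.HasExtension.val_map_le_one_iff vE w r.1).mpr r.2) hb

theorem hasExtension_comap_algHom {Ω' : Type*} [Field Ω'] [Algebra E Ω'] (vE : Valuation E ΓE)
    (w : Valuation Ω' Γ₁) [vE.HasExtension w] (φ : Ω →ₐ[E] Ω') :
    vE.HasExtension (w.comap (φ : Ω →+* Ω')) := ⟨by
  have h := Valuation.HasExtension.val_isEquiv_comap (vR := vE) (vA := w)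
  rwa [← φ.comp_algebraMap] at h⟩

variable [Algebra.IsAlgebraic E Ω]

/-- If `y ∈ Ω` lies in the valuation ring of `w`, it is a fraction of elements integral over the
valuation ring of `E`, with denominator a unit for `w`. -/
theorem exists_isIntegral_mul_eq (vE : Valuation E ΓE) (w : Valuation Ω Γ₁) [vE.HasExtension w]
    {y : Ω} (hy : w y ≤ 1) :
    ∃ u t : Ω, IsIntegral vE.valuationSubring u ∧ IsIntegral vE.valuationSubring t ∧
      w u = 1 ∧ u * y = t := by
  obtain rfl | hy0 := eq_or_ne y 0
  · exact ⟨1, 0, isIntegral_one, isIntegral_zero, map_one w, mul_zero 1⟩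
  obtain ⟨c, hc, hle, hone⟩ := exists_valuation_coeff_C_mul vE
    (minpoly.ne_zero (Algebra.IsIntegral.isIntegral (R := E) y))
  set p := C c * minpoly E y with hp
  have hpy : aeval y p = 0 := by simp [hp]
  -- `j` is the last index with a unit coefficient, so that `q j` alone will determine the value of
  -- `u`.
  obtain ⟨j, hj1, hjmax⟩ : ∃ j, vE (p.coeff j) = 1 ∧ ∀ i, j < i → vE (p.coeff i) < 1 := by
    have hfin : {i | vE (p.coeff i) = 1}.Finite := p.support.finite_toSet.subset fun i hi ↦ by
      simp only [SetLike.mem_coe, Polynomial.mem_support_iff]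
      rintro h
      simp [h] at hi
    obtain ⟨j, hj, hmax⟩ := hfin.toFinset.exists_max_image id
      ⟨hone.choose, by simpa using hone.choose_spec⟩
    simp only [Set.Finite.mem_toFinset, Set.mem_ofPred_eq, id] at hj hmax
    exact ⟨j, hj, fun i hi ↦ lt_of_le_of_ne (hle i) fun h ↦ (hmax i h).not_gt hi⟩
  set n := p.natDegree
  set q : ℕ → Ω := fun i ↦ algebraMap E Ω (p.coeff i)
  have hq (i) : IsIntegral vE.valuationSubring (q i) :=
    isIntegral_algebraMap (x := (⟨p.coeff i, hle i⟩ : vE.valuationSubring))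
  -- Cut p(y) = 0 at `j` and divide by y^(j-1): `u` is a polynomial in `y`, `t` one in `y⁻¹`, and u
  -- y = t. For j = 0 the sum in `t` is empty and u = p(y) = 0, so the truncated `j - 1` is
  -- harmless.
  set u : Ω := ∑ i ∈ Finset.range (n + 1), q (j + i) * y ^ i
  set t : Ω := -∑ i ∈ Finset.range j, q i * y⁻¹ ^ (j - 1 - i)
  have hsum : ∑ i ∈ Finset.range (j + (n + 1)), q i * y ^ i = 0 := by
    rw [← hpy, aeval_eq_sum_range' (n := j + (n + 1)) (by omega)]
    simp [q, Algebra.smul_def]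
  have hut : u * y = t := by
    obtain _ | j := j
    · simp only [zero_add] at hsum
      simp [u, t, hsum]
    rw [Finset.sum_range_add] at hsum
    have h1 : ∑ i ∈ Finset.range (j + 1), q i * y ^ i = -t * y ^ j := by
      simp only [t, neg_neg, Finset.sum_mul]
      refine Finset.sum_congr rfl fun i hi ↦ ?_
      have : i ≤ j := by simpa [Nat.lt_succ_iff] using hi
      rw [mul_assoc, inv_pow, add_tsub_cancel_right]
      congr 1
      rw [eq_inv_mul_iff_mul_eq₀ (pow_ne_zero _ hy0), ← pow_add]
      congr 1; omega
    have h2 : ∑ i ∈ Finset.range (n + 1), q (j + 1 + i) * y ^ (j + 1 + i) = u * y * y ^ j := by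
      simp only [u, Finset.sum_mul]
      exact Finset.sum_congr rfl fun i _ ↦ by ring
    rw [h1, h2] at hsum
    have : (u * y - t) * y ^ j = 0 := by linear_combination hsum
    rcases mul_eq_zero.mp this with h | h
    · exact sub_eq_zero.mp h
    · exact absurd h (pow_ne_zero _ hy0)
  let B : Subring Ω := (integralClosure vE.valuationSubring Ω).toSubring
  have : IsIntegrallyClosedIn B Ω :=
    inferInstanceAs (IsIntegrallyClosedIn (integralClosure vE.valuationSubring Ω) Ω)
  -- An integrally closed subring is the intersection of the valuation rings above it. Each of these
  -- contains `y` or `y⁻¹`, hence one of `u`, `t`, and then the other through u y = t.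
  have key (V : ValuationSubring Ω) (hV : B ≤ V.toSubring) : u ∈ V ∧ t ∈ V := by
    have hqV (i) : q i ∈ V := hV (hq i)
    rcases V.mem_or_inv_mem y with h | h
    · have hu : u ∈ V := sum_mem fun i _ ↦ mul_mem (hqV _) (pow_mem h _)
      exact ⟨hu, hut ▸ mul_mem hu h⟩
    · have ht : t ∈ V := neg_mem (sum_mem fun i _ ↦ mul_mem (hqV _) (pow_mem h _))
      refine ⟨?_, ht⟩
      rw [(mul_inv_eq_iff_eq_mul₀ hy0).mpr hut.symm |>.symm]
      exact mul_mem ht h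
  refine ⟨u, t, ?_, ?_, ?_, hut⟩
  · by_contra h
    obtain ⟨V, hV, hu⟩ := B.exists_le_valuationSubring_of_isIntegrallyClosedIn (x := u) h
    exact hu (key V hV).1
  · by_contra h
    obtain ⟨V, hV, hu⟩ := B.exists_le_valuationSubring_of_isIntegrallyClosedIn (x := t) h
    exact hu (key V hV).2
  · have hu : u = q j + ∑ i ∈ Finset.range n, q (j + (i + 1)) * y ^ (i + 1) := by
      simp only [u, Finset.sum_range_succ', add_zero, pow_zero, mul_one, add_comm]
    have hj1' : w (q j) = 1 := (Valuation.HasExtension.val_map_eq_one_iff vE w _).mpr hj1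
    suffices w (∑ i ∈ Finset.range n, q (j + (i + 1)) * y ^ (i + 1)) < 1 by
      rw [hu, Valuation.map_add_eq_of_lt_left _ (hj1'.symm ▸ this), hj1']
    refine Valuation.map_sum_lt _ one_ne_zero fun i _ ↦ ?_
    rw [map_mul, map_pow]
    exact mul_lt_one_of_lt_of_le
      ((Valuation.HasExtension.val_map_lt_one_iff vE w _).mpr (hjmax _ (by omega)))
      (pow_le_one₀ zero_le hy)

/-- Write y = t / u with `t`, `u` integral and `u` a unit for `w₁`. By the inclusion of centers `u`
is also a unit for `w₂`, while `t` has value at most 1 for `w₂`. -/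
theorem le_one_of_lt_one_imp_of_isIntegral (vE : Valuation E ΓE) (w₁ : Valuation Ω Γ₁)
    (w₂ : Valuation Ω Γ₂) [vE.HasExtension w₁] [vE.HasExtension w₂]
    (h : ∀ b : Ω, IsIntegral vE.valuationSubring b → w₂ b < 1 → w₁ b < 1) {y : Ω}
    (hy : w₁ y ≤ 1) : w₂ y ≤ 1 := by
  obtain ⟨u, t, hu, ht, hu1, hut⟩ := exists_isIntegral_mul_eq vE w₁ hy
  have h2 : w₂ u = 1 := (le_one_of_isIntegral_valuationSubring vE w₂ hu).antisymm
    (not_lt.mp fun hlt ↦ (h u hu hlt).ne hu1)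
  have h3 := congrArg w₂ hut
  rw [map_mul, h2, one_mul] at h3
  exact h3 ▸ le_one_of_isIntegral_valuationSubring vE w₂ ht

/-- Extensions of a valuation to an algebraic extension are determined by their centers on the
integral closure of the valuation ring. -/
theorem isEquiv_of_lt_one_iff_of_isIntegral (vE : Valuation E ΓE) (w₁ : Valuation Ω Γ₁)
    (w₂ : Valuation Ω Γ₂) [vE.HasExtension w₁] [vE.HasExtension w₂]
    (h : ∀ b : Ω, IsIntegral vE.valuationSubring b → (w₁ b < 1 ↔ w₂ b < 1)) :
    w₁.IsEquiv w₂ :=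
  Valuation.isEquiv_iff_val_le_one.mpr
    ⟨le_one_of_lt_one_imp_of_isIntegral vE w₁ w₂ fun b hb ↦ (h b hb).mpr,
      le_one_of_lt_one_imp_of_isIntegral vE w₂ w₁ fun b hb ↦ (h b hb).mp⟩

/-- Two extensions of a valuation to a Galois extension are conjugate. -/
theorem exists_algEquiv_isEquiv_comap [IsGalois E Ω] (vE : Valuation E ΓE) (w₁ : Valuation Ω Γ₁)
    (w₂ : Valuation Ω Γ₂) [vE.HasExtension w₁] [vE.HasExtension w₂] :
    ∃ σ : Ω ≃ₐ[E] Ω, w₁.IsEquiv (w₂.comap ((σ : Ω →ₐ[E] Ω) : Ω →+* Ω)) := by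
  obtain ⟨σ, hσ⟩ := exists_algEquiv_lt_one_iff (R := vE.valuationSubring) (L := E) w₁ w₂
    (fun r ↦ (Valuation.HasExtension.val_map_le_one_iff vE w₁ r.1).mpr r.2)
    (fun r ↦ (Valuation.HasExtension.val_map_le_one_iff vE w₂ r.1).mpr r.2)
    (fun r ↦ (Valuation.HasExtension.val_map_lt_one_iff vE w₁ r.1).trans
      (Valuation.HasExtension.val_map_lt_one_iff vE w₂ r.1).symm)
  have := hasExtension_comap_algHom vE w₂ (σ : Ω →ₐ[E] Ω)
  exact ⟨σ, isEquiv_of_lt_one_iff_of_isIntegral vE _ _ fun b hb ↦ (hσ b hb).symm⟩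

end Fractions

/-! ### Decomposition fields and separating elements -/

section Decomposition

variable {E Ω ΓE Γ : Type*} [Field E] [Field Ω] [Algebra E Ω]
  [LinearOrderedCommGroupWithZero ΓE] [LinearOrderedCommGroupWithZero Γ]

theorem mem_decompositionSubgroup_iff_isEquiv (w : Valuation Ω Γ) (σ : Ω ≃ₐ[E] Ω) :
    σ ∈ w.valuationSubring.decompositionSubgroup E ↔
      w.IsEquiv (w.comap ((σ : Ω →ₐ[E] Ω) : Ω →+* Ω)) := by
  -- The valuation ring of w ∘ σ is σ⁻¹ • V, so the stabilizer condition is tested on the inverse.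
  rw [← inv_mem_iff, MulAction.mem_stabilizer_iff, Valuation.isEquiv_iff_val_le_one]
  constructor
  · intro h x
    have : x ∈ σ⁻¹ • w.valuationSubring ↔ x ∈ w.valuationSubring := by rw [h]
    rw [ValuationSubring.mem_inv_pointwise_smul_iff] at this
    exact this.symm
  · intro h
    ext x
    rw [ValuationSubring.mem_inv_pointwise_smul_iff]
    exact h.symm

variable (E) in
/-- The decomposition field of a valuation `w` on `Ω` over `E`. -/
noncomputable def decompositionField (w : Valuation Ω Γ) : IntermediateField E Ω :=
  IntermediateField.fixedField (w.valuationSubring.decompositionSubgroup E)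

theorem mem_decompositionField_iff (w : Valuation Ω Γ) {y : Ω} :
    y ∈ decompositionField E w ↔
      ∀ σ : Ω ≃ₐ[E] Ω, w.IsEquiv (w.comap ((σ : Ω →ₐ[E] Ω) : Ω →+* Ω)) → σ y = y := by
  simp only [decompositionField, IntermediateField.mem_fixedField_iff,
    mem_decompositionSubgroup_iff_isEquiv]

/-- Among the places of a finite subextension `L` of the decomposition field, the one induced by
`w` can be separated from all its conjugates by an element of `L`. -/
theorem exists_separating_element [IsGalois E Ω] (vE : Valuation E ΓE) (w : Valuation Ω Γ)
    [vE.HasExtension w] {L : Type*} [Field L] [Algebra E L] [Algebra L Ω] [IsScalarTower E L Ω]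
    [FiniteDimensional E L] (hL : ∀ l : L, algebraMap L Ω l ∈ decompositionField E w) :
    ∃ x : L, IsIntegral vE.valuationSubring x ∧ w (algebraMap L Ω x - 1) < 1 ∧
      ∀ φ : L →ₐ[E] Ω, φ ≠ IsScalarTower.toAlgHom E L Ω → w (φ x) < 1 := by
  classical
  let O := vE.valuationSubring
  let R := integralClosure O L
  have hOL : Function.Injective (algebraMap O L) := by
    rw [IsScalarTower.algebraMap_eq O E L]
    exact (algebraMap E L).injective.comp (IsFractionRing.injective O E)
  have : Algebra.IsAlgebraic O L :=
    (IsFractionRing.comap_isAlgebraic_iff (A := O) (K := E)).mpr inferInstance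
  have : IsFractionRing R L := integralClosure.isFractionRing_of_algebraic
    fun x hx ↦ (map_eq_zero_iff _ hOL).mp hx
  have : IsIntegrallyClosed R := integralClosure.isIntegrallyClosedOfFiniteExtension E
  have : IsGalois L Ω := IsGalois.tower_top_of_isGalois E L Ω
  have hle (φ : L →ₐ[E] Ω) (r : R) : w (((φ : L →+* Ω).comp (algebraMap R L)) r) ≤ 1 := by
    have := hasExtension_comap_algHom vE w φ
    exact le_one_of_isIntegral_valuationSubring vE (w.comap (φ : L →+* Ω)) r.2
  let P (φ : L →ₐ[E] Ω) : Ideal R := w.centerAlong ((φ : L →+* Ω).comp (algebraMap R L)) (hle φ)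
  have hmem (φ) (r : R) : r ∈ P φ ↔ w (φ r) < 1 := w.mem_centerAlong _ _
  have hmax (φ) : (P φ).IsMaximal := by
    have : Algebra.IsIntegral O R := integralClosure.AlgebraIsIntegral
    refine Ideal.isMaximal_of_isIntegral_of_isMaximal_comap (R := O) _ ?_
    convert! maximalIdeal.isMaximal O
    ext r
    rw [Ideal.mem_comap, hmem, vE.mem_maximalIdeal_iff_lt_one,
      ← Valuation.HasExtension.val_map_lt_one_iff vE w, ← φ.commutes]
    rfl
  set φ₀ := IsScalarTower.toAlgHom E L Ω
  -- If the primes agree, extend φ to σ on Ω. Then w and w ∘ σ have the same center on `R`, hence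
  -- are conjugate by some τ over `L`. Now σ ∘ τ preserves w, so it fixes `L`, which forces φ = φ₀.
  have hne (φ) (hφ : φ ≠ φ₀) : P φ₀ ≠ P φ := by
    intro h
    apply hφ
    let σ : Ω ≃ₐ[E] Ω := AlgEquiv.ofBijective (φ.liftNormal Ω) (AlgHom.normal_bijective E Ω Ω _)
    have hσ (l : L) : σ (algebraMap L Ω l) = φ l := φ.liftNormal_commutes Ω l
    let w' := w.comap ((σ : Ω →ₐ[E] Ω) : Ω →+* Ω)
    have hw' (l : L) : w' (algebraMap L Ω l) = w (φ l) := congrArg w (hσ l)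
    obtain ⟨τ, hτ⟩ := exists_algEquiv_lt_one_iff (R := R) (L := L) w w' (hle φ₀)
      (fun r ↦ (hw' r).trans_le (hle φ r))
      (fun r ↦ by
        have h1 := hmem φ₀ r
        rw [h, hmem] at h1
        exact h1.symm.trans (by rw [← hw']; rfl))
    let ρ : Ω ≃ₐ[E] Ω := (τ.restrictScalars E).trans σ
    have := hasExtension_comap_algHom vE w (ρ : Ω →ₐ[E] Ω)
    have hρ : w.IsEquiv (w.comap ((ρ : Ω →ₐ[E] Ω) : Ω →+* Ω)) :=
      isEquiv_of_lt_one_iff_of_isIntegral vE _ _ fun b hb ↦ (hτ b hb.tower_top).symm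
    ext l
    have hl := (mem_decompositionField_iff w).mp (hL l) ρ hρ
    rw [← hσ]
    refine Eq.trans ?_ hl
    exact congrArg σ (τ.commutes l).symm
  -- Chinese remainder theorem: finitely many embeddings give maximal ideals different from `P φ₀`;
  -- take `x` congruent to 1 modulo `P φ₀` and lying in all the others.
  have hcop : IsCoprime (P φ₀) (⨅ φ ∈ (Finset.univ.erase φ₀ : Finset (L →ₐ[E] Ω)), P φ) :=
    Ideal.isCoprime_biInf fun φ hφ ↦
      Ideal.isCoprime_of_isMaximal (hne φ (Finset.ne_of_mem_erase hφ))
  obtain ⟨a, ha, x, hx, hax⟩ := Ideal.isCoprime_iff_exists.mp hcop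
  refine ⟨x, x.2, ?_, fun φ hφ ↦ ?_⟩
  · have : algebraMap L Ω x - 1 = -φ₀ a := by
      have := congrArg (fun r : R ↦ φ₀ r) hax
      simp only [AddMemClass.coe_add, map_add, OneMemClass.coe_one, map_one] at this
      rw [← this]
      simp [φ₀]
    rw [this, Valuation.map_neg]
    exact (hmem _ _).mp ha
  · simp only [Ideal.mem_iInf] at hx
    exact (hmem _ _).mp (hx φ (by simpa using hφ))

end Decomposition

/-! ### Polynomials over the valuation ring and Hensel's Lemma -/

section IntegralPolynomials

variable {K Γ : Type*} [Field K] [LinearOrderedCommGroupWithZero Γ] (v : Valuation K Γ)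

theorem exists_map_valuationSubring_eq {f : K[X]} (hf : ∀ i, v (f.coeff i) ≤ 1) :
    ∃ g : v.valuationSubring[X], g.map (algebraMap v.valuationSubring K) = f :=
  (Polynomial.lifts_iff_coeff_lifts f).mpr fun i ↦ ⟨⟨f.coeff i, hf i⟩, rfl⟩

theorem valuation_coeff_derivative_le_one {f : K[X]} (hf : ∀ i, v (f.coeff i) ≤ 1) (i : ℕ) :
    v (f.derivative.coeff i) ≤ 1 := by
  obtain ⟨g, rfl⟩ := exists_map_valuationSubring_eq v hf
  rw [derivative_map, coeff_map]
  exact (g.derivative.coeff i).2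

theorem exists_eval_sub_eq_mul {f : K[X]} (hf : ∀ i, v (f.coeff i) ≤ 1) {a b : K}
    (ha : v a ≤ 1) (hb : v b ≤ 1) : ∃ k, v k ≤ 1 ∧ f.eval b - f.eval a = k * (b - a) := by
  obtain ⟨g, rfl⟩ := exists_map_valuationSubring_eq v hf
  lift a to v.valuationSubring using ha
  lift b to v.valuationSubring using hb
  obtain ⟨k, hk⟩ := g.evalSubFactor b a
  refine ⟨k, k.2, ?_⟩
  have h := congrArg (algebraMap v.valuationSubring K) hk
  simp only [map_sub, map_mul, ← aeval_algebraMap_apply_eq_algebraMap_eval] at h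
  rw [eval_map_algebraMap, eval_map_algebraMap]
  exact h

theorem valuation_eval_eq_one_of_sub_lt_one {f : K[X]} (hf : ∀ i, v (f.coeff i) ≤ 1) {a b : K}
    (ha : v a ≤ 1) (hab : v (b - a) < 1) (h : v (f.eval a) = 1) : v (f.eval b) = 1 := by
  have hb : v b ≤ 1 := by simpa using v.map_add_le hab.le ha
  obtain ⟨k, hk, he⟩ := exists_eval_sub_eq_mul v hf ha hb
  rw [← sub_add_cancel (f.eval b) (f.eval a), he, Valuation.map_add_eq_of_lt_right, h]
  rw [h, map_mul]
  exact mul_lt_one_of_nonneg_of_lt_one_right hk zero_le hab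

/-- A simple approximate root is close to at most one root. -/
theorem eq_of_isRoot_of_sub_lt_one {f : K[X]} (hf : ∀ i, v (f.coeff i) ≤ 1) {a r s : K}
    (ha : v a ≤ 1) (hr : f.IsRoot r) (hs : f.IsRoot s) (hra : v (r - a) < 1)
    (hsa : v (s - a) < 1) (hu : v (f.derivative.eval a) = 1) : r = s := by
  by_contra hne
  have hfr : v (f.derivative.eval r) = 1 :=
    valuation_eval_eq_one_of_sub_lt_one v (valuation_coeff_derivative_le_one v hf) ha hra hu
  have hrs : v (s - r) < 1 := by simpa using v.map_sub_lt hsa hra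
  have hr1 : v r ≤ 1 := by simpa using v.map_add_le hra.le ha
  have hs1 : v s ≤ 1 := by simpa using v.map_add_le hsa.le ha
  obtain ⟨g, rfl⟩ := exists_map_valuationSubring_eq v hf
  lift r to v.valuationSubring using hr1
  lift s to v.valuationSubring using hs1
  -- Taylor expansion at `r` gives 0 = (f'(r) + k (s - r)) (s - r), and the first factor has value
  -- 1.
  obtain ⟨k, hk⟩ := g.binomExpansion r (s - r)
  have h := congrArg (algebraMap v.valuationSubring K) hk
  have e (x : v.valuationSubring) (g : v.valuationSubring[X]) :
      algebraMap v.valuationSubring K (g.eval x) = (g.map (algebraMap _ K)).eval (x : K) := by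
    rw [eval_map_algebraMap]
    exact (aeval_algebraMap_apply K x g).symm
  simp only [add_sub_cancel, map_add, map_mul, map_pow, map_sub, e, hr.eq_zero, hs.eq_zero,
    ← derivative_map] at h
  have h' : ((g.map (algebraMap v.valuationSubring K)).derivative.eval (r : K) +
      (k : K) * ((s : K) - r)) * ((s : K) - r) = 0 := by
    change (0 : K) = 0 + _ * ((s : K) - r) + (k : K) * ((s : K) - r) ^ 2 at h
    linear_combination -h
  rcases mul_eq_zero.mp h' with h0 | h0
  · have := Valuation.map_add_eq_of_lt_left v
      (x := (g.map (algebraMap v.valuationSubring K)).derivative.eval (r : K))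
      (y := (k : K) * ((s : K) - r)) (by
        rw [hfr, map_mul]
        exact mul_lt_one_of_nonneg_of_lt_one_right k.2 zero_le hrs)
    rw [h0, hfr, map_zero] at this
    exact zero_ne_one this
  · exact hne (sub_eq_zero.mp h0).symm

/-- The working form of Hensel's Lemma, with polynomials and roots in the field. A root close to an
integral `a` is automatically integral. -/
theorem isHenselianValuation_iff : IsHenselianValuation v ↔
    ∀ f : K[X], f.Monic → (∀ i, v (f.coeff i) ≤ 1) → ∀ a, v a ≤ 1 → v (f.eval a) < 1 →
      v (f.derivative.eval a) = 1 → ∃ r, f.IsRoot r ∧ v (r - a) < 1 := by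
  have e (x : v.valuationSubring) (g : v.valuationSubring[X]) :
      ((g.eval x : v.valuationSubring) : K) = (g.map (algebraMap _ K)).eval (x : K) := by
    rw [eval_map_algebraMap]
    exact (aeval_algebraMap_apply K x g).symm
  constructor
  · intro h f hf hfi a ha hfa hfa'
    have : HenselianLocalRing v.valuationSubring := h
    obtain ⟨g, rfl⟩ := exists_map_valuationSubring_eq v hfi
    lift a to v.valuationSubring using ha
    obtain ⟨r, hr, hra⟩ := HenselianLocalRing.is_henselian g
      (monic_of_injective (IsFractionRing.injective _ K) hf) a
      ((v.mem_maximalIdeal_iff_lt_one _).mpr (by rwa [e]))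
      ((v.isUnit_iff_eq_one _).mpr (by rwa [e, ← derivative_map]))
    refine ⟨r, ?_, (v.mem_maximalIdeal_iff_lt_one _).mp hra⟩
    rw [IsRoot.def, ← e, hr.eq_zero]
    rfl
  · intro h
    refine { is_henselian := fun g hg a hga hga' ↦ ?_ }
    obtain ⟨r, hr, hra⟩ := h (g.map (algebraMap _ K)) (hg.map _)
      (fun i ↦ by rw [coeff_map]; exact (g.coeff i).2) a a.2
      (by rw [← e]; exact (v.mem_maximalIdeal_iff_lt_one _).mp hga)
      (by rw [derivative_map, ← e]; exact (v.isUnit_iff_eq_one _).mp hga')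
    have hr1 : v r ≤ 1 := by simpa using v.map_add_le hra.le a.2
    lift r to v.valuationSubring using hr1
    refine ⟨r, ?_, (v.mem_maximalIdeal_iff_lt_one _).mpr hra⟩
    rw [IsRoot.def, ← e] at hr
    exact Subtype.ext hr

end IntegralPolynomials

/-! ### The decomposition field is henselian and generated by Hensel roots -/

theorem multiset_prod_le_one {Γ : Type*} [LinearOrderedCommGroupWithZero Γ] {s : Multiset Γ}
    (hs : ∀ a ∈ s, a ≤ 1) : s.prod ≤ 1 := by
  induction s using Multiset.induction with
  | empty => simp
  | cons a s ih =>
    rw [Multiset.prod_cons]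
    exact mul_le_one' (hs a (Multiset.mem_cons_self a s))
      (ih fun b hb ↦ hs b (Multiset.mem_cons_of_mem hb))

section DecompositionField

variable {E Ω ΓE Γ : Type*} [Field E] [Field Ω] [Algebra E Ω] [IsAlgClosed Ω]
  [LinearOrderedCommGroupWithZero ΓE] [LinearOrderedCommGroupWithZero Γ]

/-- In Ω, f(a) is the product of the a - r over the roots r, so some root is close to `a`. The
decomposition group fixes `f` and `a` and preserves w, so it sends this root to a root close to `a`;
by uniqueness the root is fixed. -/
theorem isHenselianValuation_decompositionField (w : Valuation Ω Γ) :
    IsHenselianValuation (w.comap (algebraMap (decompositionField E w) Ω)) := by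
  rw [isHenselianValuation_iff]
  intro f hf hfi a ha hfa hfa'
  set i := algebraMap (decompositionField E w) Ω
  have hfi' (n) : w ((f.map i).coeff n) ≤ 1 := by rw [coeff_map]; exact hfi n
  have hder : w ((f.map i).derivative.eval (i a)) = 1 := by
    rw [derivative_map, eval_map_apply]; exact hfa'
  have hev : w ((f.map i).eval (i a)) < 1 := by rw [eval_map_apply]; exact hfa
  obtain ⟨r, hr, hra⟩ : ∃ r, (f.map i).IsRoot r ∧ w (r - i a) < 1 := by
    by_contra! hcon
    refine hev.not_ge ?_
    rw [(IsAlgClosed.splits (f.map i)).eval_eq_prod_roots_of_monic (hf.map i), map_multiset_prod,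
      Multiset.map_map]
    refine Multiset.one_le_prod_of_one_le fun x hx ↦ ?_
    obtain ⟨r, hr, rfl⟩ := Multiset.mem_map.mp hx
    rw [Function.comp_apply, Valuation.map_sub_swap]
    exact hcon r (isRoot_of_mem_roots hr)
  have hrH : r ∈ decompositionField E w := by
    rw [mem_decompositionField_iff]
    intro σ hσ
    have hσi (b) : σ (i b) = i b := (mem_decompositionField_iff w).mp b.2 σ hσ
    refine eq_of_isRoot_of_sub_lt_one w hfi' (a := i a) ha ?_ hr ?_ hra hder
    · have h1 := congrArg σ hr.eq_zero
      have h2 : ((σ : Ω →ₐ[E] Ω) : Ω →+* Ω).comp i = i := RingHom.ext hσi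
      rw [map_zero, eval_map] at h1
      have h3 := hom_eval₂ f i ((σ : Ω →ₐ[E] Ω) : Ω →+* Ω) r
      rw [h2] at h3
      rw [IsRoot.def, eval_map]
      exact h3.symm.trans h1
    · have h1 : w (σ (r - i a)) < 1 := by
        rw [hσ.lt_one_iff_lt_one] at hra
        exact hra
      rwa [map_sub, hσi] at h1
  refine ⟨⟨r, hrH⟩, ?_, hra⟩
  have h1 := hr.eq_zero
  rw [IsRoot.def]
  apply i.injective
  rw [map_zero, ← h1, ← eval_map_apply]
  rfl

/-- Elements of the decomposition field are polynomials in an element `z` which is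
characterized by being the root close to `1` of a polynomial over the valuation ring with `1` as a
simple approximate root. -/
theorem exists_hensel_generator [IsGalois E Ω] (vE : Valuation E ΓE) (w : Valuation Ω Γ)
    [vE.HasExtension w] {y : Ω} (hy : y ∈ decompositionField E w) :
    ∃ z ∈ decompositionField E w, w (z - 1) < 1 ∧ (∃ p : E[X], aeval z p = y) ∧
      ∃ f : E[X], f.Monic ∧ (∀ i, vE (f.coeff i) ≤ 1) ∧ vE (f.eval 1) < 1 ∧
        vE (f.derivative.eval 1) = 1 ∧ aeval z f = 0 := by
  classical
  open IntermediateField in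
  have hyint : IsIntegral E y := Algebra.IsIntegral.isIntegral y
  have : FiniteDimensional E E⟮y⟯ := adjoin.finiteDimensional hyint
  have hyle : E⟮y⟯ ≤ decompositionField E w := by
    rw [adjoin_le_iff]
    rintro _ rfl
    exact hy
  -- The conjugates of `x` other than itself have value less than 1, so its minimal polynomial
  -- reduces to (X - 1) X^(d-1), with 1 a simple root.
  obtain ⟨x, hx, hx1, hxφ⟩ := exists_separating_element vE w (L := E⟮y⟯) fun l ↦ hyle l.2
  set z : Ω := algebraMap E⟮y⟯ Ω x with hz
  have hzw : w z = 1 := by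
    have := Valuation.map_add_eq_of_lt_left w (x := 1) (y := z - 1) (by rwa [map_one])
    simpa using this
  have hzint : IsIntegral vE.valuationSubring z := hx.algebraMap
  have hzE : IsIntegral E z := Algebra.IsIntegral.isIntegral z
  have hconj (σ : Ω ≃ₐ[E] Ω) : (∀ l : E⟮y⟯, σ l = l) ∨ w (σ z) < 1 := by
    by_cases h : (σ : Ω →ₐ[E] Ω).comp (IsScalarTower.toAlgHom E E⟮y⟯ Ω) =
        IsScalarTower.toAlgHom E E⟮y⟯ Ω
    · exact .inl (DFunLike.congr_fun h)
    · exact .inr (hxφ _ h)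
  have hroot (r : Ω) (hr : r ∈ ((minpoly E z).map (algebraMap E Ω)).roots) (hrz : r ≠ z) :
      w r < 1 := by
    have hr' : aeval r (minpoly E z) = 0 := by
      rw [aeval_def, ← eval_map]; exact isRoot_of_mem_roots hr
    obtain ⟨σ, rfl⟩ := minpoly.exists_algEquiv_of_root' hzE.isAlgebraic hr'
    exact (hconj σ).resolve_left fun h ↦ hrz (h x)
  have hzroot : z ∈ ((minpoly E z).map (algebraMap E Ω)).roots := by
    rw [mem_roots ((minpoly.monic hzE).map _).ne_zero, IsRoot.def, eval_map, ← aeval_def,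
      minpoly.aeval]
  have hcoeff (i) : vE ((minpoly E z).coeff i) ≤ 1 := by
    rw [minpoly.isIntegrallyClosed_eq_field_fractions' E hzint, coeff_map]
    exact ((minpoly vE.valuationSubring z).coeff i).2
  have hmon := (minpoly.monic hzE).map (algebraMap E Ω)
  have hspl := IsAlgClosed.splits ((minpoly E z).map (algebraMap E Ω))
  refine ⟨z, hyle x.2, hx1, ?_, minpoly E z, minpoly.monic hzE, hcoeff, ?_, ?_, minpoly.aeval E z⟩
  -- An automorphism fixing `z` also fixes `y`: otherwise it would send `z`, of value 1, to an
  -- element of value less than 1.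
  · have hmem : y ∈ E⟮z⟯ := by
      rw [← InfiniteGalois.fixedField_fixingSubgroup E⟮z⟯, mem_fixedField_iff]
      intro σ hσ
      refine (hconj σ).resolve_right (fun h ↦ h.ne ?_) (AdjoinSimple.gen E y)
      rw [(mem_fixingSubgroup_iff _ σ).mp hσ z (mem_adjoin_simple_self E z), hzw]
    rw [← mem_toSubalgebra, adjoin_simple_toSubalgebra_of_isAlgebraic hzE.isAlgebraic,
      Algebra.adjoin_singleton_eq_range_aeval] at hmem
    exact hmem
  · rw [← Valuation.HasExtension.val_map_lt_one_iff vE w, ← eval_map_apply, map_one,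
      hspl.eval_eq_prod_roots_of_monic hmon, ← Multiset.cons_erase hzroot, Multiset.map_cons,
      Multiset.prod_cons, map_mul, Valuation.map_sub_swap]
    refine mul_lt_one_of_lt_of_le hx1 ?_
    rw [map_multiset_prod, Multiset.map_map]
    refine multiset_prod_le_one fun a ha ↦ ?_
    obtain ⟨r, hr, rfl⟩ := Multiset.mem_map.mp ha
    refine w.map_sub_le (map_one w).le ?_
    by_cases hrz : r = z
    · rw [hrz, hzw]
    · exact (hroot r (Multiset.mem_of_mem_erase hr) hrz).le
  · rw [← Valuation.HasExtension.val_map_eq_one_iff vE w, ← eval_map_apply, map_one,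
      ← derivative_map]
    refine valuation_eval_eq_one_of_sub_lt_one w (a := z)
      (valuation_coeff_derivative_le_one w fun i ↦ ?_) hzw.le (by rwa [Valuation.map_sub_swap]) ?_
    · rw [coeff_map, Valuation.HasExtension.val_map_le_one_iff vE w]
      exact hcoeff i
    -- The derivative at `z` is the product of the z - r over the other roots, each factor of value
    -- 1. The value at 1 is then the same, since `z` is close to 1.
    rw [hspl.eval_root_derivative hmon hzroot, map_multiset_prod, Multiset.map_map]
    refine Multiset.prod_eq_one fun a ha ↦ ?_
    obtain ⟨r, hr, rfl⟩ := Multiset.mem_map.mp ha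
    have hnd : ((minpoly E z).map (algebraMap E Ω)).roots.Nodup :=
      nodup_roots (Polynomial.Separable.map (Algebra.IsSeparable.isSeparable E z))
    have hrz : r ≠ z := fun h ↦ hnd.notMem_erase (h ▸ hr)
    rw [Function.comp_apply, Valuation.map_sub_eq_of_lt_left, hzw]
    rw [hzw]
    exact hroot r (Multiset.mem_of_mem_erase hr) hrz

end DecompositionField

/-! ### Extension of valuations and the universal property of the henselization -/

/-- Every valuation extends to every extension field. -/
theorem exists_valuationSubring_hasExtension {M N ΓM : Type*} [Field M] [Field N] [Algebra M N]
    [LinearOrderedCommGroupWithZero ΓM] (vM : Valuation M ΓM) :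
    ∃ A : ValuationSubring N, vM.HasExtension A.valuation := by
  obtain ⟨A, hA, hloc⟩ := IsLocalRing.exists_factor_valuationRing
    ((algebraMap M N).comp (algebraMap vM.valuationSubring M))
  refine ⟨A, ⟨Valuation.isEquiv_iff_val_le_one.mpr fun {x} ↦ ?_⟩⟩
  rw [Valuation.comap_apply, A.valuation_le_one_iff]
  refine ⟨fun hx ↦ hA ⟨x, hx⟩, fun hx ↦ ?_⟩
  -- Otherwise x⁻¹ is a nonunit of the valuation ring of `M` that becomes a unit in `A`, against
  -- locality of the map.
  by_contra! hlt
  have hx0 : x ≠ 0 := by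
    rintro rfl
    simp at hlt
  have hinv : vM x⁻¹ < 1 := by
    rw [map_inv₀]
    exact inv_lt_one_of_one_lt₀ hlt
  let y : vM.valuationSubring := ⟨x⁻¹, hinv.le⟩
  have hy : IsUnit y := by
    refine hloc.map_nonunit y (IsUnit.of_mul_eq_one ⟨algebraMap M N x, hx⟩ (Subtype.ext ?_))
    change algebraMap M N x⁻¹ * algebraMap M N x = 1
    rw [← map_mul, inv_mul_cancel₀ hx0, map_one]
  exact hinv.ne ((vM.isUnit_iff_eq_one y).mp hy)

theorem hasExtension_trans {E M N ΓE ΓM ΓN : Type*} [Field E] [Field M] [Field N] [Algebra E M]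
    [Algebra M N] [Algebra E N] [IsScalarTower E M N] [LinearOrderedCommGroupWithZero ΓE]
    [LinearOrderedCommGroupWithZero ΓM] [LinearOrderedCommGroupWithZero ΓN]
    (vE : Valuation E ΓE) (vM : Valuation M ΓM) (vN : Valuation N ΓN) [vE.HasExtension vM]
    [vM.HasExtension vN] : vE.HasExtension vN := ⟨Valuation.isEquiv_iff_val_le_one.mpr fun {x} ↦ by
  rw [Valuation.comap_apply, IsScalarTower.algebraMap_apply E M N,
    Valuation.HasExtension.val_map_le_one_iff vM vN,
    Valuation.HasExtension.val_map_le_one_iff vE vM]⟩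

section Henselization

variable {E ΓE Γ : Type*} {Ω : Type u} [Field E] [Field Ω] [Algebra E Ω]
  [LinearOrderedCommGroupWithZero ΓE] [LinearOrderedCommGroupWithZero Γ]

/-- This rigidity determines where an embedding sends a Hensel generator; both existence and
uniqueness of embeddings rest on it. -/
theorem eq_of_aeval_eq_zero_of_sub_one_lt_one {M ΓM : Type*} [Field M] [Algebra E M]
    [LinearOrderedCommGroupWithZero ΓM] (vE : Valuation E ΓE) (vM : Valuation M ΓM)
    [vE.HasExtension vM] {f : E[X]} (hf : ∀ i, vE (f.coeff i) ≤ 1)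
    (hf' : vE (f.derivative.eval 1) = 1) {a b : M} (ha : aeval a f = 0) (hb : aeval b f = 0)
    (ha1 : vM (a - 1) < 1) (hb1 : vM (b - 1) < 1) : a = b := by
  refine eq_of_isRoot_of_sub_lt_one vM (f := f.map (algebraMap E M)) (fun i ↦ ?_) (a := 1)
    (map_one vM).le ?_ ?_ ha1 hb1 ?_
  · rw [coeff_map, Valuation.HasExtension.val_map_le_one_iff vE vM]
    exact hf i
  · rwa [IsRoot.def, eval_map_algebraMap]
  · rwa [IsRoot.def, eval_map_algebraMap]
  · rwa [derivative_map, ← map_one (algebraMap E M), eval_map_apply,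
      Valuation.HasExtension.val_map_eq_one_iff vE vM]

/-- The decomposition field of an extension of `vE` to an algebraic closure is a henselization. -/
theorem isHenselization_decompositionField [IsAlgClosed Ω] [IsGalois E Ω] (vE : Valuation E ΓE)
    (w : Valuation Ω Γ) [vE.HasExtension w] :
    IsHenselization vE (w.comap (algebraMap (decompositionField E w) Ω)) where
  hasExtension := hasExtension_comap_algHom vE w (decompositionField E w).val
  henselian := isHenselianValuation_decompositionField w
  existsUnique_embedding := by
    intro M _ _ ΓM _ vM hM hhens
    have hval {φ : decompositionField E w →ₐ[E] M}
        (hφ : (w.comap (algebraMap (decompositionField E w) Ω)).IsEquiv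
          (vM.comap (φ : decompositionField E w →+* M))) {z : decompositionField E w}
        (hz : w ((z : Ω) - 1) < 1) : vM (φ z - 1) < 1 := by
      have h1 : (w.comap (algebraMap (decompositionField E w) Ω)) (z - 1) < 1 := by
        rw [Valuation.comap_apply, map_sub, map_one]
        exact hz
      rw [hφ.lt_one_iff_lt_one, Valuation.comap_apply, map_sub, map_one] at h1
      exact h1
    rw [isHenselianValuation_iff] at hhens
    apply existsUnique_of_exists_of_unique
    -- Existence: embed Ω in an algebraic closure of `M`, corrected by a conjugation so as to
    -- preserve values. Each generator `z` then goes to the Hensel root close to 1, which already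
    -- lies in `M`, so the decomposition field lands in `M`.
    · let N := AlgebraicClosure M
      obtain ⟨A, hA⟩ := exists_valuationSubring_hasExtension (N := N) vM
      have hEA : vE.HasExtension A.valuation := hasExtension_trans vE vM A.valuation
      let ψ₀ : Ω →ₐ[E] N := IsAlgClosed.lift
      have := hasExtension_comap_algHom vE A.valuation ψ₀
      obtain ⟨σ, hσ⟩ := exists_algEquiv_isEquiv_comap vE w
        (A.valuation.comap (ψ₀ : Ω →+* N))
      let ψ : Ω →ₐ[E] N := ψ₀.comp (σ : Ω →ₐ[E] Ω)
      have hψ : w.IsEquiv (A.valuation.comap (ψ : Ω →+* N)) := hσ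
      let ι : M →ₐ[E] N := IsScalarTower.toAlgHom E M N
      have hrange (y : decompositionField E w) :
          (ψ.comp (decompositionField E w).val) y ∈ ι.range := by
        obtain ⟨z, -, hz1, ⟨p, hp⟩, f, hfm, hfi, hf1, hf1', hfz⟩ :=
          exists_hensel_generator vE w y.2
        obtain ⟨r, hr, hr1⟩ := hhens (f.map (algebraMap E M)) (hfm.map _)
          (fun i ↦ by
            rw [coeff_map, Valuation.HasExtension.val_map_le_one_iff vE vM]
            exact hfi i) 1 (map_one vM).le
          (by rwa [← map_one (algebraMap E M), eval_map_apply,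
            Valuation.HasExtension.val_map_lt_one_iff vE vM])
          (by rwa [derivative_map, ← map_one (algebraMap E M), eval_map_apply,
            Valuation.HasExtension.val_map_eq_one_iff vE vM])
        have hrz : ι r = ψ z := by
          refine eq_of_aeval_eq_zero_of_sub_one_lt_one vE A.valuation hfi hf1' ?_ ?_ ?_ ?_
          · rw [aeval_algHom_apply, ← eval_map_algebraMap, hr.eq_zero, map_zero]
          · rw [aeval_algHom_apply, hfz, map_zero]
          · rw [← Valuation.HasExtension.val_map_lt_one_iff vM A.valuation, map_sub, map_one] at hr1
            exact hr1
          · rw [hψ.lt_one_iff_lt_one, Valuation.comap_apply, map_sub, map_one] at hz1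
            exact hz1
        refine ⟨aeval r p, ?_⟩
        change ι (aeval r p) = ψ y
        rw [← aeval_algHom_apply, hrz, aeval_algHom_apply, hp]
      let e := AlgEquiv.ofInjective ι (ι : M →+* N).injective
      let φ : decompositionField E w →ₐ[E] M :=
        (e.symm : ι.range →ₐ[E] M).comp
          ((ψ.comp (decompositionField E w).val).codRestrict ι.range hrange)
      have hφ (y : decompositionField E w) : algebraMap M N (φ y) = ψ y :=
        congrArg Subtype.val (e.apply_symm_apply ⟨ψ y, hrange y⟩)
      refine ⟨φ, Valuation.isEquiv_iff_val_le_one.mpr fun {y} ↦ ?_⟩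
      have h1 := Valuation.isEquiv_iff_val_le_one.mp hψ (x := (y : Ω))
      refine h1.trans ?_
      rw [Valuation.comap_apply, Valuation.comap_apply,
        ← Valuation.HasExtension.val_map_le_one_iff vM A.valuation]
      exact iff_of_eq (congrArg (fun t ↦ A.valuation t ≤ 1) (hφ y).symm)
    · intro φ₁ φ₂ h₁ h₂
      ext y
      obtain ⟨z, hz, hz1, ⟨p, hp⟩, f, hfm, hfi, hf1, hf1', hfz⟩ := exists_hensel_generator vE w y.2
      lift z to decompositionField E w using hz
      have hfz' : aeval z f = 0 := Subtype.ext (by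
        rw [← IntermediateField.aeval_coe]
        exact hfz)
      have hp' : aeval z p = y := Subtype.ext (by rw [← IntermediateField.aeval_coe, hp])
      have heq : φ₁ z = φ₂ z := eq_of_aeval_eq_zero_of_sub_one_lt_one vE vM hfi hf1'
        (by rw [aeval_algHom_apply, hfz', map_zero]) (by rw [aeval_algHom_apply, hfz', map_zero])
        (hval h₁ hz1) (hval h₂ hz1)
      rw [← hp', ← aeval_algHom_apply, ← aeval_algHom_apply, heq]

end Henselization

/-! ### The decomposition field is immediate -/

section Approximation

variable {E Ω ΓE Γ : Type*} [Field E] [Field Ω] [Algebra E Ω]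
  [LinearOrderedCommGroupWithZero ΓE] [LinearOrderedCommGroupWithZero Γ]

/-- If no element of `s` has the same value as `z`, then one coefficient of `∏ (z X - r)` dominates
all the others. -/
theorem exists_dominant_coeff (w : Valuation Ω Γ) {z : Ω} (hz : z ≠ 0) (s : Multiset Ω)
    (hs : ∀ r ∈ s, w r ≠ w z) :
    ∃ (l : Ω) (t : ℕ), l ≠ 0 ∧
      ∀ j, w ((s.map fun r ↦ C z * X - C r).prod.coeff j - if j = t then l else 0) < w l := by
  induction s using Multiset.induction with
  | empty =>
    refine ⟨1, 0, one_ne_zero, fun j ↦ ?_⟩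
    simp [coeff_one]
  | cons r s ih =>
    obtain ⟨l, t, hl, h⟩ := ih fun r hr ↦ hs r (Multiset.mem_cons_of_mem hr)
    set q := (s.map fun r ↦ C z * X - C r).prod
    have hle (j) : w (q.coeff j) ≤ w l := by
      have h1 : w (if j = t then l else 0) ≤ w l := by split_ifs <;> simp
      simpa using w.map_add_le (h j).le h1
    have hl0 : 0 < w l := zero_lt_iff.mpr ((map_ne_zero w).mpr hl)
    have hz0 : 0 < w z := zero_lt_iff.mpr ((map_ne_zero w).mpr hz)
    rw [Multiset.map_cons, Multiset.prod_cons]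
    change ∃ l t, l ≠ 0 ∧ ∀ j, w (((C z * X - C r) * q).coeff j - _) < w l
    -- A root smaller than `z` makes `z X` dominate its factor, shifting the dominant degree by one;
    -- a larger root makes the constant `-r` dominate and leaves the degree unchanged.
    rcases lt_or_gt_of_ne (hs r (Multiset.mem_cons_self r s)) with hr | hr
    · refine ⟨z * l, t + 1, mul_ne_zero hz hl, fun j ↦ ?_⟩
      rw [sub_mul, mul_assoc, coeff_sub, coeff_C_mul, coeff_C_mul, map_mul w z l, sub_right_comm]
      refine w.map_sub_lt ?_ ?_
      · obtain _ | j := j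
        · simpa using mul_pos hz0 hl0
        · rw [coeff_X_mul]
          have : z * q.coeff j - (if j + 1 = t + 1 then z * l else 0) =
              z * (q.coeff j - if j = t then l else 0) := by
            simp only [add_left_inj, mul_sub, mul_ite, mul_zero]
          rw [this, map_mul]
          exact mul_lt_mul_of_pos_left (h j) hz0
      · rw [map_mul]
        exact (mul_le_mul_right (hle j) _).trans_lt (mul_lt_mul_of_pos_right hr hl0)
    · have hr0 : 0 < w r := hz0.trans hr
      refine ⟨-(r * l), t, neg_ne_zero.mpr (mul_ne_zero ((map_ne_zero w).mp hr0.ne') hl),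
        fun j ↦ ?_⟩
      rw [sub_mul, mul_assoc, coeff_sub, coeff_C_mul, coeff_C_mul, Valuation.map_neg, map_mul w r l]
      have : z * (X * q).coeff j - r * q.coeff j - (if j = t then -(r * l) else 0) =
          z * (X * q).coeff j - r * (q.coeff j - if j = t then l else 0) := by
        split_ifs <;> ring
      rw [this]
      refine w.map_sub_lt ?_ ?_
      · rw [map_mul]
        refine (mul_le_mul_right (?_ : _ ≤ w l) _).trans_lt (mul_lt_mul_of_pos_right hr hl0)
        obtain _ | j := j
        · simp
        · rw [coeff_X_mul]
          exact hle j
      · rw [map_mul]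
        exact mul_lt_mul_of_pos_left (h j) hr0

/-- An element whose value differs from the values of all its other conjugates can be approximated
by an element of the base field. -/
theorem exists_sub_lt_of_conjugates_ne [IsAlgClosed Ω] [IsGalois E Ω] (w : Valuation Ω Γ) {z : Ω}
    (hz : z ≠ 0) (hconj : ∀ σ : Ω ≃ₐ[E] Ω, σ z ≠ z → w (σ z) ≠ w z) :
    ∃ c : E, w (z - algebraMap E Ω c) < w z := by
  classical
  have hzE : IsIntegral E z := Algebra.IsIntegral.isIntegral z
  set f := (minpoly E z).map (algebraMap E Ω) with hf
  have hmon : f.Monic := (minpoly.monic hzE).map _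
  have hzroot : z ∈ f.roots := by
    rw [mem_roots hmon.ne_zero, IsRoot.def, hf, eval_map, ← aeval_def, minpoly.aeval]
  have hnd : f.roots.Nodup :=
    nodup_roots (Polynomial.Separable.map (Algebra.IsSeparable.isSeparable E z))
  obtain ⟨l, t, hl, h⟩ := exists_dominant_coeff w hz (f.roots.erase z) fun r hr ↦ by
    have hr' : aeval r (minpoly E z) = 0 := by
      rw [aeval_def, ← eval_map]; exact isRoot_of_mem_roots (Multiset.mem_of_mem_erase hr)
    obtain ⟨σ, rfl⟩ := minpoly.exists_algEquiv_of_root' hzE.isAlgebraic hr'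
    exact hconj σ fun h ↦ hnd.notMem_erase (h ▸ hr)
  set q := ((f.roots.erase z).map fun r ↦ C z * X - C r).prod
  have hcomp : f.comp (C z * X) = C z * (X - 1) * q := by
    conv_lhs => rw [(IsAlgClosed.splits f).eq_prod_roots_of_monic hmon,
      ← Multiset.cons_erase hzroot]
    rw [multiset_prod_comp, Multiset.map_map, Multiset.map_cons, Multiset.prod_cons]
    congr 1
    · simp [mul_sub]
    · refine congrArg _ (Multiset.map_congr rfl fun r _ ↦ ?_)
      simp
  have hcoeff (j) : f.coeff j * z ^ j = (C z * (X - 1) * q).coeff j := by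
    rw [← hcomp, comp_C_mul_X_coeff]
  have hA : f.coeff t * z ^ t = z * ((X * q).coeff t - q.coeff t) := by
    rw [hcoeff, mul_assoc, coeff_C_mul, sub_mul, one_mul, coeff_sub]
  have hB : f.coeff (t + 1) * z ^ (t + 1) = z * (q.coeff t - q.coeff (t + 1)) := by
    rw [hcoeff, mul_assoc, coeff_C_mul, sub_mul, one_mul, coeff_sub, coeff_X_mul]
  have hz0 : 0 < w z := zero_lt_iff.mpr ((map_ne_zero w).mpr hz)
  have hl0 : 0 < w l := zero_lt_iff.mpr ((map_ne_zero w).mpr hl)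
  have h1 : w (q.coeff (t + 1)) < w l := by simpa using h (t + 1)
  have h2 : w (q.coeff t - l) < w l := by simpa using h t
  have h3 : w ((X * q).coeff t) < w l := by
    obtain _ | t := t
    · simpa using hl0
    · rw [coeff_X_mul]
      simpa using h t
  have hBval : w (q.coeff t - q.coeff (t + 1)) = w l := by
    have : q.coeff t - q.coeff (t + 1) = l + (q.coeff t - l - q.coeff (t + 1)) := by ring
    rw [this, w.map_add_eq_of_lt_left (w.map_sub_lt h2 h1)]
  have hB0 : q.coeff t - q.coeff (t + 1) ≠ 0 := by
    rw [← map_ne_zero w, hBval]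
    exact hl0.ne'
  have hf0 : f.coeff (t + 1) ≠ 0 := by
    intro h0
    rw [h0, zero_mul] at hB
    exact mul_ne_zero hz hB0 hB.symm
  -- Since q is dominated by l X^t, f(zX) = z (X - 1) q is close to z l (X^(t+1) - X^t). Comparing
  -- the coefficients of degrees t and t + 1 shows that -f_t / f_(t+1) is close to z.
  refine ⟨-((minpoly E z).coeff t / (minpoly E z).coeff (t + 1)), ?_⟩
  have hdiff : (z - algebraMap E Ω (-((minpoly E z).coeff t / (minpoly E z).coeff (t + 1)))) *
      (q.coeff t - q.coeff (t + 1)) = z * ((X * q).coeff t - q.coeff (t + 1)) := by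
    have hquot : f.coeff t / f.coeff (t + 1) =
        z * ((X * q).coeff t - q.coeff t) / (q.coeff t - q.coeff (t + 1)) := by
      rw [div_eq_div_iff hf0 hB0]
      apply mul_right_cancel₀ (pow_ne_zero (t + 1) hz)
      rw [mul_assoc _ (f.coeff (t + 1)), hB, ← hA]
      ring
    rw [map_neg, map_div₀, ← coeff_map, ← coeff_map, ← hf, sub_neg_eq_add, hquot, add_mul,
      div_mul_cancel₀ _ hB0]
    ring
  have hv := congrArg w hdiff
  rw [map_mul, map_mul, hBval] at hv
  refine lt_of_mul_lt_mul_right ?_ (zero_le (a := w l))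
  rw [hv]
  exact mul_lt_mul_of_pos_left (w.map_sub_lt h3 h1) hz0

/-- The decomposition field is an immediate extension. -/
theorem exists_sub_lt_of_mem_decompositionField [IsAlgClosed Ω] [IsGalois E Ω]
    (vE : Valuation E ΓE) (w : Valuation Ω Γ) [vE.HasExtension w] {y : Ω}
    (hy : y ∈ decompositionField E w) (hy0 : y ≠ 0) :
    ∃ c : E, w (y - algebraMap E Ω c) < w y := by
  open IntermediateField in
  have : FiniteDimensional E E⟮y⟯ := adjoin.finiteDimensional (Algebra.IsIntegral.isIntegral y)
  have hyle : E⟮y⟯ ≤ decompositionField E w := by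
    rw [adjoin_le_iff]
    rintro _ rfl
    exact hy
  obtain ⟨x, -, hx1, hxφ⟩ := exists_separating_element vE w (L := E⟮y⟯) fun l ↦ hyle l.2
  set φ₀ := IsScalarTower.toAlgHom E E⟮y⟯ Ω
  have hxw : w (x : Ω) = 1 := by
    have := Valuation.map_add_eq_of_lt_left w (x := 1) (y := (x : Ω) - 1) (by rwa [map_one])
    simpa using this
  have hx0 : x ≠ 0 := by
    rintro rfl
    simp at hxw
  let g : E⟮y⟯ := AdjoinSimple.gen E y
  have hg0 : g ≠ 0 := fun h ↦ hy0 (congrArg Subtype.val h)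
  -- For each other embedding φ, |φ x|^k |φ y| is strictly decreasing in k and equals |y| at most
  -- once. Some k avoids all these coincidences, and x^k y is close to `y` because `x` is close to
  -- 1.
  have hfin : (⋃ φ : {φ : E⟮y⟯ →ₐ[E] Ω // φ ≠ φ₀},
      {k : ℕ | w (φ.1 x) ^ k * w (φ.1 g) = w y}).Finite := by
    refine Set.finite_iUnion fun φ ↦ Set.Subsingleton.finite fun k hk k' hk' ↦ ?_
    have hpos : 0 < w (φ.1 x) := zero_lt_iff.mpr
      ((map_ne_zero w).mpr ((map_ne_zero φ.1).mpr hx0))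
    have hne : w (φ.1 g) ≠ 0 := (map_ne_zero w).mpr ((map_ne_zero φ.1).mpr hg0)
    exact (pow_right_strictAnti₀ hpos (hxφ φ.1 φ.2)).injective
      (mul_right_cancel₀ hne (Eq.trans hk (Eq.symm hk')))
  obtain ⟨k, hk⟩ := hfin.exists_notMem
  simp only [Set.mem_iUnion, not_exists] at hk
  let z : Ω := (x : Ω) ^ k * y
  have hzw : w z = w y := by simp [z, hxw]
  have hz0 : z ≠ 0 := by rwa [← _root_.map_ne_zero w, hzw, _root_.map_ne_zero]
  obtain ⟨c, hc⟩ := exists_sub_lt_of_conjugates_ne (E := E) w hz0 fun σ hσ ↦ by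
    have hne : (σ : Ω →ₐ[E] Ω).comp φ₀ ≠ φ₀ := fun h ↦
      hσ (DFunLike.congr_fun h (x ^ k * g))
    have := hk ⟨_, hne⟩
    rw [hzw]
    intro h
    apply this
    rw [← h, map_mul σ, map_pow σ, map_mul w, map_pow w]
    rfl
  refine ⟨c, ?_⟩
  have hzy : w (y - z) < w y := by
    have hk1 : w (1 - (x : Ω) ^ k) < 1 := by
      rw [Valuation.map_sub_swap, ← mul_geom_sum, map_mul]
      exact mul_lt_one_of_lt_of_le hx1 (w.map_sum_le fun i _ ↦ by simp [hxw])
    have : y - z = (1 - (x : Ω) ^ k) * y := by simp only [z]; ring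
    rw [this, map_mul]
    exact mul_lt_of_lt_one_left (zero_lt_iff.mpr ((map_ne_zero w).mpr hy0)) hk1
  have := w.map_add_lt hzy (hzw ▸ hc)
  simpa using this

end Approximation

/-! ### Averaging over the orbit of the decomposition group -/

section Trace

variable {E F Ω Γ : Type*} [Field E] [Field F] [Field Ω] [Algebra E F] [Algebra F Ω]
  [Algebra E Ω] [IsScalarTower E F Ω] [LinearOrderedCommGroupWithZero Γ]

theorem decompositionField_mono (w : Valuation Ω Γ) {y : Ω} (hy : y ∈ decompositionField E w) :
    y ∈ decompositionField F w := by
  rw [mem_decompositionField_iff] at hy ⊢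
  exact fun σ hσ ↦ hy (σ.restrictScalars E) hσ

/-- An element of `F` lies in the decomposition field over `E`, provided the elements of the
decomposition field over `F` are approximated well enough by elements of `E`. -/
theorem algebraMap_mem_decompositionField [CharZero Ω] [Algebra.IsAlgebraic E Ω]
    (w : Valuation Ω Γ)
    (happrox : ∀ n : ℕ, n ≠ 0 → ∀ y ∈ decompositionField F w, y ≠ 0 →
      ∃ c : E, w (y - algebraMap E Ω c) < w (n : Ω) * w y) (a : F) :
    algebraMap F Ω a ∈ decompositionField E w := by
  classical
  set α := algebraMap F Ω a with hα
  let O : Set Ω := {b | ∃ σ : Ω ≃ₐ[E] Ω,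
    w.IsEquiv (w.comap ((σ : Ω →ₐ[E] Ω) : Ω →+* Ω)) ∧ σ α = b}
  have hfin : O.Finite := by
    refine (Polynomial.rootSet_finite (minpoly E α) Ω).subset ?_
    rintro _ ⟨σ, -, rfl⟩
    rw [mem_rootSet]
    refine ⟨minpoly.ne_zero (Algebra.IsIntegral.isIntegral α), ?_⟩
    have := aeval_algHom_apply (σ : Ω →ₐ[E] Ω) α (minpoly E α)
    rw [minpoly.aeval, map_zero] at this
    exact this
  let s := hfin.toFinset
  have hs (b) : b ∈ s ↔ ∃ σ : Ω ≃ₐ[E] Ω,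
    w.IsEquiv (w.comap ((σ : Ω →ₐ[E] Ω) : Ω →+* Ω)) ∧ σ α = b := hfin.mem_toFinset
  have hstable (σ : Ω ≃ₐ[E] Ω) (hσ : w.IsEquiv (w.comap ((σ : Ω →ₐ[E] Ω) : Ω →+* Ω))) :
      ∀ b ∈ s, σ b ∈ s := by
    intro b hb
    obtain ⟨τ, hτ, rfl⟩ := (hs b).mp hb
    refine (hs _).mpr ⟨σ * τ, ?_, rfl⟩
    rw [← mem_decompositionSubgroup_iff_isEquiv] at hσ hτ ⊢
    exact mul_mem hσ hτ
  have hαs : α ∈ s := (hs α).mpr ⟨1, Valuation.IsEquiv.refl, rfl⟩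
  have hn : s.card ≠ 0 := Finset.card_ne_zero_of_mem hαs
  have hnΩ : (s.card : Ω) ≠ 0 := Nat.cast_ne_zero.mpr hn
  let m : Ω := (∑ b ∈ s, b) / s.card
  have hm : m ∈ decompositionField E w := by
    rw [mem_decompositionField_iff]
    intro σ hσ
    simp only [m, map_div₀, map_natCast, map_sum]
    congr 1
    have himg : s.image σ = s := Finset.eq_of_subset_of_card_le
      (Finset.image_subset_iff.mpr (hstable σ hσ))
      (Finset.card_image_of_injective s σ.injective).ge
    conv_rhs => rw [← himg, Finset.sum_image σ.injective.injOn]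
  suffices α - m = 0 by rwa [sub_eq_zero.mp this]
  by_contra hx0
  have hxF : α - m ∈ decompositionField F w := by
    refine sub_mem ?_ (decompositionField_mono w hm)
    exact (decompositionField F w).algebraMap_mem a
  obtain ⟨c, hc⟩ := happrox s.card hn _ hxF hx0
  have hn1 : w (s.card : Ω) ≤ 1 := natCast_mem w.valuationSubring s.card
  set d := algebraMap E Ω c
  -- σ carries the estimate for α to b = σ α. Stating the bound through `d`, which σ fixes, makes it
  -- the same for the whole orbit.
  have key (b) (hb : b ∈ s) : w (b - m - d) < w (s.card : Ω) * w d := by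
    obtain ⟨σ, hσ, rfl⟩ := (hs b).mp hb
    have hσm : σ m = m := (mem_decompositionField_iff w).mp hm σ hσ
    have h1 : w (σ (α - m - d)) < w (σ ((s.card : Ω) * (α - m))) := by
      rw [← map_mul] at hc
      exact hσ.lt_iff_lt.mp hc
    simp only [map_sub σ, map_mul σ, map_natCast σ, hσm, map_mul w] at h1
    rw [σ.commutes] at h1
    have h2 : w (σ α - m - d) < w (σ α - m) :=
      h1.trans_le (mul_le_of_le_one_left zero_le hn1)
    have h3 : w (σ α - m) = w d := by
      have := w.map_sub_eq_of_lt_left h2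
      rw [sub_sub_cancel] at this
      exact this.symm
    rwa [h3] at h1
  have hd0 : w (s.card : Ω) * w d ≠ 0 := ((zero_le).trans_lt (key α hαs)).ne'
  have hsum := w.map_sum_lt hd0 key
  -- The b - m sum to zero because `m` is the mean, so only the constant contributes.
  have : ∑ b ∈ s, (b - m - d) = -((s.card : Ω) * d) := by
    rw [Finset.sum_sub_distrib, Finset.sum_sub_distrib, Finset.sum_const, Finset.sum_const,
      nsmul_eq_mul, nsmul_eq_mul, mul_div_cancel₀ _ hnΩ]
    ring
  rw [this, Valuation.map_neg, map_mul] at hsum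
  exact hsum.false

end Trace

/-! ### Sharper approximation from finite ramification -/

section FiniteRamification

variable {K Γ : Type*} [Field K] [LinearOrderedCommGroupWithZero Γ] (v : Valuation K Γ)

theorem valuation_natCast_eq_one_of_not_dvd {p : ℕ} (hp : p.Prime) (hv : v (p : K) < 1) {m : ℕ}
    (hm : ¬ p ∣ m) : v (m : K) = 1 := by
  refine (show v (m : K) ≤ 1 from natCast_mem v.valuationSubring m).antisymm ?_
  by_contra! hlt
  have hcop : IsCoprime (p : ℤ) (m : ℤ) := Nat.isCoprime_iff_coprime.mpr
    ((Nat.Prime.coprime_iff_not_dvd hp).mpr hm)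
  obtain ⟨a, b, hab⟩ := hcop
  have hint (a : ℤ) : v (a : K) ≤ 1 := intCast_mem v.valuationSubring a
  have h := congrArg (fun k : ℤ ↦ v (k : K)) hab
  simp only [Int.cast_add, Int.cast_mul, Int.cast_natCast, Int.cast_one, map_one] at h
  refine h.not_lt (v.map_add_lt ?_ ?_) <;> rw [map_mul]
  · exact mul_lt_one_of_nonneg_of_lt_one_right (hint a) zero_le hv
  · exact mul_lt_one_of_nonneg_of_lt_one_right (hint b) zero_le hlt

theorem exists_valuation_natCast_eq_pow {p : ℕ} (hp : p.Prime) (hv : v (p : K) < 1) {n : ℕ}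
    (hn : n ≠ 0) : ∃ k, v (n : K) = v (p : K) ^ k := by
  obtain ⟨k, m, hm, rfl⟩ := Nat.exists_eq_pow_mul_and_not_dvd hn p hp.ne_one
  refine ⟨k, ?_⟩
  rw [Nat.cast_mul, map_mul, valuation_natCast_eq_one_of_not_dvd v hp hv hm, mul_one,
    Nat.cast_pow, map_pow]

theorem valuation_natCast_eq_one_of_hasResidueCharZero (h : HasResidueCharZero v) {n : ℕ}
    (hn : n ≠ 0) : v (n : K) = 1 := by
  have : CharZero (ResidueField v.valuationSubring) := h
  have h1 : residue v.valuationSubring (n : v.valuationSubring) ≠ 0 := by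
    rw [map_natCast]
    exact Nat.cast_ne_zero.mpr hn
  rw [residue_ne_zero_iff_isUnit, v.isUnit_iff_eq_one] at h1
  simpa using h1

theorem charZero_of_hasResidueCharZero_or_isFinitelyRamified
    (h : HasResidueCharZero v ∨ IsFinitelyRamified v) : CharZero K := by
  refine charZero_of_inj_zero fun n hn ↦ ?_
  by_contra hn0
  rcases h with h | ⟨p, hp, hp0, hv, -⟩
  · simpa [hn] using valuation_natCast_eq_one_of_hasResidueCharZero v h hn0
  · obtain ⟨k, hk⟩ := exists_valuation_natCast_eq_pow v hp hv hn0
    rw [hn, map_zero] at hk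
    exact pow_ne_zero k ((map_ne_zero v).mpr hp0) hk.symm

variable {Ω ΓΩ : Type*} [Field Ω] [Algebra K Ω] [LinearOrderedCommGroupWithZero ΓΩ]
  (w : Valuation Ω ΓΩ) [v.HasExtension w]

/-- Otherwise the ratios |y - c| / |y| below 1 all lie in [|p|, 1). By immediacy they are values of
elements of `K`, so there are finitely many; approximating y - c once more at the smallest ratio
gives a smaller one. -/
theorem exists_sub_lt_mul_of_finite {p : K} (hp0 : p ≠ 0)
    (hfin : {γ : Γ | γ ∈ Set.range v ∧ v p < γ ∧ γ < 1}.Finite) (Y : Set Ω)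
    (hY : ∀ y ∈ Y, ∀ c : K, y - algebraMap K Ω c ∈ Y)
    (himm : ∀ y ∈ Y, y ≠ 0 → ∃ c : K, w (y - algebraMap K Ω c) < w y) {y : Ω} (hy : y ∈ Y)
    (hy0 : y ≠ 0) : ∃ c : K, w (y - algebraMap K Ω c) < w (algebraMap K Ω p) * w y := by
  by_contra! hcon
  have hwy : 0 < w y := zero_lt_iff.mpr ((map_ne_zero w).mpr hy0)
  have hwp : 0 < w (algebraMap K Ω p) := by simpa [zero_lt_iff] using hp0
  have hne (c : K) : y - algebraMap K Ω c ≠ 0 := by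
    rw [← map_ne_zero w]
    exact ((mul_pos hwp hwy).trans_le (hcon c)).ne'
  have hval (y) (hy : y ∈ Y) (hy0 : y ≠ 0) : ∃ d : K, w (algebraMap K Ω d) = w y := by
    obtain ⟨c, hc⟩ := himm y hy hy0
    refine ⟨c, ?_⟩
    simpa using w.map_sub_eq_of_lt_left hc
  obtain ⟨d, hd⟩ := hval y hy hy0
  let S : Set Γ := {γ | ∃ c e : K, w (y - algebraMap K Ω c) < w y ∧
    w (algebraMap K Ω e) = w (y - algebraMap K Ω c) ∧ γ = v (e / d)}
  have hdiv (e : K) : w (algebraMap K Ω (e / d)) = w (algebraMap K Ω e) / w y := by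
    rw [map_div₀, map_div₀, hd]
  have hS : S.Finite := by
    refine (hfin.union (Set.finite_singleton (v p))).subset ?_
    rintro _ ⟨c, e, hc, he, rfl⟩
    have h1 : v (e / d) < 1 := by
      rw [← Valuation.HasExtension.val_map_lt_one_iff v w, hdiv, he, div_lt_one₀ hwy]
      exact hc
    have h2 : v p ≤ v (e / d) := by
      rw [← Valuation.HasExtension.val_map_le_iff v w, hdiv, he, le_div_iff₀ hwy]
      exact hcon c
    rcases h2.eq_or_lt with h | h
    · exact .inr h.symm
    · exact .inl ⟨⟨_, rfl⟩, h, h1⟩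
  have hSne : S.Nonempty := by
    obtain ⟨c, hc⟩ := himm y hy hy0
    obtain ⟨e, he⟩ := hval _ (hY y hy c) (hne c)
    exact ⟨_, c, e, hc, he, rfl⟩
  obtain ⟨_, ⟨c, e, hc, he, rfl⟩, hmin⟩ := S.exists_min_image id hS hSne
  obtain ⟨c', hc'⟩ := himm _ (hY y hy c) (hne c)
  rw [sub_sub, ← map_add] at hc'
  obtain ⟨e', he'⟩ := hval _ (hY y hy (c + c')) (hne (c + c'))
  have h1 := hmin _ ⟨c + c', e', hc'.trans hc, he', rfl⟩
  refine h1.not_gt ?_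
  rw [id, id, ← Valuation.HasExtension.val_map_lt_iff v w, hdiv, hdiv, he, he']
  exact div_lt_div_of_pos_right hc' hwy

/-- Over a valued field with residue characteristic zero or finite ramification, immediate
approximation can be improved by the value of any nonzero natural number. -/
theorem exists_sub_lt_natCast_mul (h : HasResidueCharZero v ∨ IsFinitelyRamified v) (Y : Set Ω)
    (hY : ∀ y ∈ Y, ∀ c : K, y - algebraMap K Ω c ∈ Y)
    (himm : ∀ y ∈ Y, y ≠ 0 → ∃ c : K, w (y - algebraMap K Ω c) < w y) {n : ℕ} (hn : n ≠ 0)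
    {y : Ω} (hy : y ∈ Y) (hy0 : y ≠ 0) :
    ∃ c : K, w (y - algebraMap K Ω c) < w (n : Ω) * w y := by
  rcases h with h | ⟨p, hp, hp0, hvp, hfin⟩
  · have h1 : w (n : Ω) = 1 := by
      rw [← map_natCast (algebraMap K Ω), Valuation.HasExtension.val_map_eq_one_iff v w]
      exact valuation_natCast_eq_one_of_hasResidueCharZero v h hn
    simpa [h1] using himm y hy hy0
  · have hwp1 : w (p : Ω) < 1 := by
      rwa [← map_natCast (algebraMap K Ω), Valuation.HasExtension.val_map_lt_one_iff v w]
    have hwp0 : 0 < w (p : Ω) := by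
      rw [← map_natCast (algebraMap K Ω)]
      simpa only [zero_lt_iff, ne_eq, map_eq_zero] using hp0
    have hwy : 0 < w y := zero_lt_iff.mpr ((map_ne_zero w).mpr hy0)
    obtain ⟨k, hk⟩ := exists_valuation_natCast_eq_pow w hp hwp1 hn
    rw [hk]
    clear hk hn
    -- Each further approximation gains a factor |p|, so k rounds after the first reach |p|^k = |n|.
    induction k with
    | zero => simpa using himm y hy hy0
    | succ k ih =>
      obtain ⟨c, hc⟩ := ih
      by_cases h0 : y - algebraMap K Ω c = 0
      · refine ⟨c, ?_⟩
        rw [h0, map_zero]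
        exact mul_pos (pow_pos hwp0 _) hwy
      obtain ⟨c', hc'⟩ := exists_sub_lt_mul_of_finite v w hp0 hfin Y hY himm (hY y hy c) h0
      refine ⟨c + c', ?_⟩
      rw [map_add, ← sub_sub]
      refine hc'.trans ?_
      rw [map_natCast, pow_succ', mul_assoc]
      exact mul_lt_mul_of_pos_left hc hwp0

end FiniteRamification

/-! ### Immediate extensions and the main theorem -/

/-- Equality of value groups gives x in `K` with |x| = |y|, and equality of residue fields gives a
in `K` with the residue of y / x; then x a approximates y. -/
theorem IsImmediate.exists_sub_lt {K F ΓK ΓF : Type*} [Field K] [Field F] [Algebra K F]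
    [LinearOrderedCommGroupWithZero ΓK] [LinearOrderedCommGroupWithZero ΓF]
    {vK : Valuation K ΓK} {vF : Valuation F ΓF} [vK.HasExtension vF] (h : IsImmediate vK vF)
    {y : F} (hy : y ≠ 0) : ∃ c : K, vF (y - algebraMap K F c) < vF y := by
  obtain ⟨x, hx0, hx⟩ := h.1 y hy
  have hx0' : algebraMap K F x ≠ 0 := (_root_.map_ne_zero _).mpr hx0
  have hwy : 0 < vF y := zero_lt_iff.mpr ((map_ne_zero vF).mpr hy)
  have hu : vF (y / algebraMap K F x) ≤ 1 := by rw [map_div₀, hx, div_self hwy.ne']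
  obtain ⟨r, hr⟩ := h.2 (residue _ ⟨y / algebraMap K F x, hu⟩)
  obtain ⟨a, rfl⟩ := residue_surjective r
  rw [Valuation.HasExtension.algebraMap_residue_eq_residue_algebraMap, eq_comm, ← sub_eq_zero,
    ← map_sub, residue_eq_zero_iff, vF.mem_maximalIdeal_iff_lt_one] at hr
  change vF (y / algebraMap K F x - algebraMap K F a) < 1 at hr
  refine ⟨x * a, ?_⟩
  have : y - algebraMap K F (x * a) =
      algebraMap K F x * (y / algebraMap K F x - algebraMap K F a) := by
    rw [mul_sub, mul_div_cancel₀ _ hx0', map_mul]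
  rw [this, map_mul, hx]
  exact mul_lt_of_lt_one_right hwy hr

theorem liesInHenselization_of_isTranscendenceBasis {K F Ω ΓK ΓF ΓΩ : Type*} [Field K] [Field F]
    [Field Ω] [Algebra K F] [Algebra F Ω] [IsAlgClosure F Ω]
    [LinearOrderedCommGroupWithZero ΓK] [LinearOrderedCommGroupWithZero ΓF]
    [LinearOrderedCommGroupWithZero ΓΩ]
    (vK : Valuation K ΓK) (hK : HasResidueCharZero vK ∨ IsFinitelyRamified vK)
    (vF : Valuation F ΓF) [vK.HasExtension vF] (himm : IsImmediate vK vF)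
    (w : Valuation Ω ΓΩ) [vF.HasExtension w] {T : Set F}
    (hT : IsTranscendenceBasis K ((↑) : T → F)) : LiesInHenselization K vF w T := by
  have : CharZero K := charZero_of_hasResidueCharZero_or_isFinitelyRamified vK hK
  have : CharZero F := charZero_of_injective_algebraMap (algebraMap K F).injective
  have : CharZero Ω := charZero_of_injective_algebraMap (algebraMap F Ω).injective
  have : IsAlgClosed Ω := IsAlgClosure.isAlgClosed F
  have : Algebra.IsAlgebraic F Ω := IsAlgClosure.isAlgebraic
  have : IsGalois F Ω := IsAlgClosure.isGalois F Ω
  let E := IntermediateField.adjoin K T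
  have : CharZero E := charZero_of_injective_algebraMap (algebraMap K E).injective
  have : Algebra.IsAlgebraic E F := by
    have := hT.isAlgebraic_field
    rwa [Subtype.range_coe] at this
  have : Algebra.IsAlgebraic E Ω := Algebra.IsAlgebraic.trans E F Ω
  have : IsAlgClosure E Ω := ⟨inferInstance, inferInstance⟩
  have : IsGalois E Ω := IsAlgClosure.isGalois E Ω
  let vE := vF.comap (algebraMap E F)
  have hEF : vE.HasExtension vF := ⟨Valuation.IsEquiv.refl⟩
  have hEΩ : vE.HasExtension w := hasExtension_trans vE vF w
  refine ⟨decompositionField E w, isHenselization_decompositionField vE w, ?_⟩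
  rintro _ ⟨a, rfl⟩
  let : Algebra K Ω := ((algebraMap F Ω).comp (algebraMap K F)).toAlgebra
  have : IsScalarTower K F Ω := .of_algebraMap_eq fun _ ↦ rfl
  have : vK.HasExtension w := hasExtension_trans vK vF w
  refine algebraMap_mem_decompositionField (E := E) (F := F) w (fun n hn y hy hy0 ↦ ?_) a
  -- Immediacy of F^h over `K` is obtained in two steps: `y` is approximated by `b` in `F`, and `b`,
  -- of the same value, by `c` in `K`.
  obtain ⟨c, hc⟩ := exists_sub_lt_natCast_mul vK w hK (decompositionField F w : Set Ω)
    (fun y hy c ↦ sub_mem hy ((decompositionField F w).algebraMap_mem (algebraMap K F c)))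
    (fun y hy hy0 ↦ by
      obtain ⟨b, hb⟩ := exists_sub_lt_of_mem_decompositionField vF w hy hy0
      have hby : w (algebraMap F Ω b) = w y := by
        simpa using w.map_sub_eq_of_lt_left hb
      have hb0 : b ≠ 0 := by
        rintro rfl
        rw [map_zero, map_zero, eq_comm, map_eq_zero] at hby
        exact hy0 hby
      obtain ⟨c, hc⟩ := himm.exists_sub_lt hb0
      rw [← Valuation.HasExtension.val_map_lt_iff vF w, hby, map_sub] at hc
      refine ⟨c, ?_⟩
      rw [IsScalarTower.algebraMap_apply K F Ω]
      simpa using w.map_add_lt hb hc) hn hy hy0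
  exact ⟨algebraMap K E c, hc⟩

theorem mainTheorem10 {K F Ω ΓK ΓF ΓΩ : Type*} [Field K] [Field F] [Field Ω]
    [Algebra K F] [Algebra F Ω] [IsAlgClosure F Ω]
    [LinearOrderedCommGroupWithZero ΓK] [LinearOrderedCommGroupWithZero ΓF]
    [LinearOrderedCommGroupWithZero ΓΩ]
    (vK : Valuation K ΓK) (hK : HasResidueCharZero vK ∨ IsFinitelyRamified vK)
    (vF : Valuation F ΓF) [vK.HasExtension vF]
    (hF : IsFunctionField K F) (himm : IsImmediate vK vF)
    (w : Valuation Ω ΓΩ) [vF.HasExtension w] :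
    IsHenselianRational K vF w ∧
      ∀ T : Set F, IsTranscendenceBasis K ((↑) : T → F) → LiesInHenselization K vF w T := by
  have hall (T : Set F) (hT : IsTranscendenceBasis K ((↑) : T → F)) :
      LiesInHenselization K vF w T :=
    liesInHenselization_of_isTranscendenceBasis vK hK vF himm w hT
  obtain ⟨T, hT⟩ := exists_isTranscendenceBasis K F
  exact ⟨⟨T, hT, hall T hT⟩, hall⟩
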